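/- For a nonempty topological space $Y$ and a finite open cover $\alpha$ of $Y$, let $\operatorname{ord}(\alpha)=\sup_{y\in Y}\#\{U\in\alpha: y\in U\}-1$, let $D(\alpha)$ be the minimum of $\operatorname{ord}(\beta)$ over all finite open covers $\beta$ of $Y$ that refine $\alpha$, and let $\dim(Y)=\sup_\alpha D(\alpha)\in\mathbb{N}\cup\{\infty\}$, the supremum being over all finite open covers $\alpha$ of $Y$ (the topological dimension of $Y$); put $\dim(\emptyset)=0$. For a homeomorphism $T$ of a compact metrizable space $X$ let $P_k=\{x\in X: T^p x=x \text{ for some } 1\le p\le k\}$ and $$\operatorname{perdim}(X,T)=\sup_{k\ge 1}\frac{\dim(P_k)}{k}\in[0,\infty].$$ Let $(X_i)_{i\ge 1}$ be compact metrizable spaces of finite topological dimension, let $T_i$ be a homeomorphism of $X_i$ for each $i$, and let $(X,T)=\left(\prod_{i\ge1}X_i,\prod_{i\ge1}T_i\right)$ be the product system, $X^{(n)}=X_1\times\dots\times X_n$ and $T^{(n)}=T_1\times\dots\times T_n$. Let $d$ be a natural number and suppose that $$\liminf_{n\to\infty}\operatorname{perdim}\left(X^{(n)},T^{(n)}\right)<\frac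 d2 .$$ Then $(X,T)$ embeds in $\left(([0,1]^d)^{\mathbb{Z}},\sigma\right)$, where $\sigma$ is the shift $(\sigma y)_n=y_{n+1}$: there is a map $\varphi:X\to([0,1]^d)^{\mathbb{Z}}$ that is a homeomorphism onto its image and satisfies $\varphi\circ T=\sigma\circ\varphi$. -/

import Mathlib

open Filter Topology
open scoped ENNReal

noncomputable section

namespace PeriodicDim

/-- `α` is a finite open cover of `X`. -/
def IsFiniteOpenCover {X : Type*} [TopologicalSpace X] (α : Set (Set X)) : Prop :=
  α.Finite ∧ (∀ U ∈ α, IsOpen U) ∧ ⋃₀ α = Set.univ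

/-- `β` refines `α`: every member of `β` is contained in a member of `α`. -/
def Refines {X : Type*} (β α : Set (Set X)) : Prop :=
  ∀ V ∈ β, ∃ U ∈ α, V ⊆ U

/-- The order of a cover: the supremum over the points `x` of the number of members that contain
`x`, minus one. -/
def coverOrder {X : Type*} (α : Set (Set X)) : ℕ∞ :=
  ⨆ x : X, ({U | U ∈ α ∧ x ∈ U}.encard - 1)

/-- `D(α)`: the least order of a finite open cover that refines `α`. -/
def minOrder {X : Type*} [TopologicalSpace X] (α : Set (Set X)) : ℕ∞ :=
  ⨅ (β : Set (Set X)) (_ : IsFiniteOpenCover β ∧ Refines β α), coverOrder β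

/-- The topological (Lebesgue covering) dimension: the supremum of `D(α)` over all finite open
covers `α`. The empty space gets the value `0`; since a periodic dimension is a supremum over all
`k ≥ 1`, it would be the same number with the convention `-1`. -/
def topDim (X : Type*) [TopologicalSpace X] : ℕ∞ :=
  ⨆ (α : Set (Set X)) (_ : IsFiniteOpenCover α), minOrder α

/-- `P_k`: the points that are periodic under `T` of period at most `k`. -/
def periodicLE {X : Type*} (T : X → X) (k : ℕ) : Set X :=
  {x | ∃ p : ℕ, 1 ≤ p ∧ p ≤ k ∧ Function.IsPeriodicPt T p x}

/-- The periodic dimension `perdim (X, T) = sup_{k ≥ 1} dim (P_k) / k`. -/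
def perdim {X : Type*} [TopologicalSpace X] (T : X ≃ₜ X) : ℝ≥0∞ :=
  ⨆ (k : ℕ) (_ : 1 ≤ k), ((topDim (periodicLE T k) : ℕ∞) : ℝ≥0∞) / (k : ℝ≥0∞)

/-- The bilateral shift on `Y^ℤ`, `(σ y)_n = y_{n+1}`. -/
def shift (Y : Type*) [TopologicalSpace Y] : (ℤ → Y) ≃ₜ (ℤ → Y) where
  toFun y n := y (n + 1)
  invFun y n := y (n - 1)
  left_inv y := by funext n; simp
  right_inv y := by funext n; simp
  continuous_toFun := continuous_pi fun n => continuous_apply (n + 1)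
  continuous_invFun := continuous_pi fun n => continuous_apply (n - 1)

/-- The system `(X, T)` embeds in the system `(Y, S)`: there is a topological embedding of `X`
into `Y` that intertwines `T` and `S`. -/
def EmbedsIn {X Y : Type*} [TopologicalSpace X] [TopologicalSpace Y]
    (T : X ≃ₜ X) (S : Y ≃ₜ Y) : Prop :=
  ∃ φ : X → Y, IsEmbedding φ ∧ φ ∘ T = S ∘ φ

/-- The product of a sequence of systems, acting coordinatewise. -/
def prodSystem {X : ℕ → Type*} [∀ i, TopologicalSpace (X i)] (T : ∀ i, X i ≃ₜ X i) :
    (∀ i, X i) ≃ₜ (∀ i, X i) :=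
  Homeomorph.piCongrRight T

/-- The product of the first `n` systems of a sequence, acting coordinatewise. -/
def finProdSystem {X : ℕ → Type*} [∀ i, TopologicalSpace (X i)] (T : ∀ i, X i ≃ₜ X i) (n : ℕ) :
    (∀ i : Fin n, X i) ≃ₜ (∀ i : Fin n, X i) :=
  Homeomorph.piCongrRight fun i : Fin n => T i

end PeriodicDim

end

namespace PeriodicDim

-- It suffices to find a continuous `f : X → ℝ^d` for which `x ↦ (f (T^k x))` over `k ≥ 0` is
-- injective: compactness turns injectivity into an embedding, and `ℝ` is squeezed injectively into
-- the unit interval.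
--
-- For a finite-dimensional system with `perdim < d/2`, a residual set of `f` works
-- (`eventually_residual_orbit_map_injective`). Pairs `x ≠ y` are sorted into countably many classes
-- by their periods. Near a given pair, `f` is perturbed along disjoint translates to a combination
-- of vertices in general position, weighted by a partition of unity. A coincidence of orbit data
-- then has `n + m` free barycentric parameters but must satisfy `d` equations for each comparison
-- time. Points without short periods offer as many times as desired. Points of period `p` offer
-- only `p`, and `2 * dim P_p < p * d` is exactly what is needed. If `f` fails to separate two
-- points of one orbit, its values along the orbit have a period `g` properly dividing `p`; this is
-- excluded by comparing at `p - g ≥ p/2` times.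
--
-- The infinite product need not be finite-dimensional. However, a compact set of pairs off the
-- diagonal is already separated by finitely many coordinates, and `f` is uniformly close to
-- functions of finitely many coordinates. Hence arbitrarily large `n` with `perdim < d/2` make
-- separation on such a set open and dense (`dense_separating_of_isCompact`), and Baire finishes.

universe u

/-! ### Covering dimension and fine partitions of unity -/

/-- Partitions of unity on `K` of multiplicity at most `n + 1` and with arbitrarily small
supports. -/
def HasFinePartitions {X : Type u} [MetricSpace X] (K : Set X) (n : ℕ) : Prop :=
  ∀ δ : ℝ, 0 < δ → ∃ (ι : Type) (_ : Fintype ι) (φ : ι → C(X, ℝ)),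
    (∀ i x, 0 ≤ φ i x) ∧ (∀ x ∈ K, ∑ i, φ i x = 1) ∧
    (∀ x ∈ K, ∃ S : Finset ι, S.card ≤ n + 1 ∧ ∀ i ∉ S, φ i x = 0) ∧
    ∀ i, ∀ x ∈ K, ∀ y ∈ K, φ i x ≠ 0 → φ i y ≠ 0 → dist x y < δ

lemma HasFinePartitions.mono {X : Type u} [MetricSpace X] {K L : Set X} {n : ℕ}
    (h : HasFinePartitions K n) (hLK : L ⊆ K) : HasFinePartitions L n := by
  intro δ hδ
  obtain ⟨ι, hι, φ, h0, h1, hS, hd⟩ := h δ hδ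
  exact ⟨ι, hι, φ, h0, fun x hx => h1 x (hLK hx), fun x hx => hS x (hLK hx),
    fun i x hx y hy => hd i x (hLK hx) y (hLK hy)⟩

lemma exists_refinement_of_topDim_le {Y : Type u} [TopologicalSpace Y] {n : ℕ}
    (h : topDim Y ≤ n) {α : Set (Set Y)} (hα : IsFiniteOpenCover α) :
    ∃ β : Set (Set Y), IsFiniteOpenCover β ∧ Refines β α ∧
      ∀ y, {U | U ∈ β ∧ y ∈ U}.encard ≤ n + 1 := by
  have h1 : minOrder α ≤ n := (le_iSup₂ (f := fun α (_ : IsFiniteOpenCover α) => minOrder α) α hα).trans h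
  -- A strict bound by `n + 1` lets the infimum be replaced by an actual cover.
  have h2 : minOrder α < (n : ℕ∞) + 1 := lt_of_le_of_lt h1 (by exact_mod_cast Nat.lt_succ_self n)
  simp only [minOrder, iInf_lt_iff] at h2
  obtain ⟨β, ⟨hβ, hr⟩, hlt⟩ := h2
  refine ⟨β, hβ, hr, fun y => ?_⟩
  have h3 : coverOrder β ≤ n := ENat.lt_add_one_iff (ENat.natCast_ne_top n) |>.1 hlt
  have h4 := (le_iSup (fun x : Y => ({U | U ∈ β ∧ x ∈ U}.encard - 1)) y).trans h3
  exact tsub_le_iff_right.1 h4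

lemma hasFinePartitions_range_of_topDim_le {X Y : Type u} [MetricSpace X] [CompactSpace X]
    [TopologicalSpace Y] {j : Y → X} (hj : IsClosedEmbedding j) {n : ℕ} (h : topDim Y ≤ n) :
    HasFinePartitions (Set.range j) n := by
  intro δ hδ
  obtain ⟨t, -, htf, ht⟩ := (isCompact_univ (X := X)).finite_cover_balls (half_pos hδ)
  obtain ⟨β, ⟨hβf, hβo, hβu⟩, hβr, hβn⟩ := exists_refinement_of_topDim_le h
    (α := (fun x => j ⁻¹' Metric.ball x (δ / 2)) '' t)
    ⟨htf.image _, by rintro _ ⟨x, -, rfl⟩; exact Metric.isOpen_ball.preimage hj.continuous, by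
      rw [Set.sUnion_image]
      refine Set.eq_univ_of_forall fun y => ?_
      simpa using ht (Set.mem_univ (j y))⟩
  have : Finite β := hβf
  obtain ⟨k, ⟨e⟩⟩ := Finite.exists_equiv_fin β
  -- Open sets of `X` with the given traces let the partition functions be defined on all of `X`, so
  -- that they can later be composed with homeomorphisms of `X`.
  have hW : ∀ i : Fin k, ∃ W : Set X, IsOpen W ∧ j ⁻¹' W = (e.symm i : Set Y) :=
    fun i => hj.isInducing.isOpen_iff.1 (hβo _ (e.symm i).2)
  choose W hWo hWe using hW
  have hcover : Set.range j ⊆ ⋃ i, W i := by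
    rintro _ ⟨y, rfl⟩
    have : y ∈ ⋃₀ β := hβu ▸ Set.mem_univ _
    obtain ⟨U, hU, hyU⟩ := this
    refine Set.mem_iUnion.2 ⟨e ⟨U, hU⟩, ?_⟩
    have h5 := hWe (e ⟨U, hU⟩)
    rw [Equiv.symm_apply_apply] at h5
    have : y ∈ j ⁻¹' W (e ⟨U, hU⟩) := h5 ▸ hyU
    exact this
  obtain ⟨φ, hφ⟩ := PartitionOfUnity.exists_isSubordinate hj.isClosed_range W hWo hcover
  have hmem : ∀ i y, φ i (j y) ≠ 0 → y ∈ (e.symm i : Set Y) := by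
    intro i y h
    rw [← hWe i]
    exact hφ i (subset_tsupport _ h)
  refine ⟨Fin k, inferInstance, fun i => φ i, fun i x => φ.nonneg i x, fun x hx => ?_, ?_, ?_⟩
  · rw [← finsum_eq_sum_of_fintype]
    exact φ.sum_eq_one hx
  · rintro _ ⟨y, rfl⟩
    classical
    refine ⟨Finset.univ.filter fun i => φ i (j y) ≠ 0, ?_, fun i hi => by simpa using hi⟩
    have h6 : ((Finset.univ.filter fun i => φ i (j y) ≠ 0 : Finset (Fin k)) :
        Set (Fin k)).encard ≤ {U | U ∈ β ∧ y ∈ U}.encard := by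
      refine Set.encard_le_encard_of_injOn (f := fun i => (e.symm i : Set Y)) ?_ ?_
      · intro i hi
        exact ⟨(e.symm i).2, hmem i y (by simpa using hi)⟩
      · intro i _ i' _ hii
        exact e.symm.injective (Subtype.ext hii)
    rw [Set.encard_coe_eq_coe_finsetCard] at h6
    exact_mod_cast h6.trans (hβn _)
  · rintro i _ ⟨x, rfl⟩ _ ⟨y, rfl⟩ hx hy
    obtain ⟨_, ⟨z, -, rfl⟩, hsub⟩ := hβr _ (e.symm i).2
    have hxz := Metric.mem_ball.1 (hsub (hmem i x hx))
    have hyz := Metric.mem_ball.1 (hsub (hmem i y hy))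
    have := dist_triangle_right (j x) (j y) z
    linarith

lemma hasFinePartitions_of_topDim_le {X : Type u} [MetricSpace X] [CompactSpace X] {K : Set X}
    (hK : IsClosed K) {n : ℕ} (h : topDim K ≤ n) : HasFinePartitions K n := by
  simpa using hasFinePartitions_range_of_topDim_le hK.isClosedEmbedding_subtypeVal h

lemma hasFinePartitions_univ_of_topDim_le {X : Type u} [MetricSpace X] [CompactSpace X]
    {n : ℕ} (h : topDim X ≤ n) : HasFinePartitions (Set.univ : Set X) n := by
  simpa using hasFinePartitions_range_of_topDim_le (X := X) IsClosedEmbedding.id h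

/-- Products of partition functions. The bound is far from optimal, but only its finiteness matters:
it is used for pairs with a point free of short periods, where the number of times can be chosen
large. -/
lemma HasFinePartitions.pi {ι : Type} [Fintype ι] {X : ι → Type u} [∀ i, MetricSpace (X i)]
    {n : ι → ℕ} (h : ∀ i, HasFinePartitions (Set.univ : Set (X i)) (n i)) :
    HasFinePartitions (Set.univ : Set (∀ i, X i)) (∏ i, (n i + 1)) := by
  classical
  intro δ hδ
  choose κ hκ φ h0 h1 hS hd using fun i => h i δ hδ
  refine ⟨∀ i, κ i, inferInstance,
    fun k => ⟨fun x => ∏ i, φ i (k i) (x i), by fun_prop⟩,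
    fun k x => Finset.prod_nonneg fun i _ => h0 i _ _, fun x _ => ?_, fun x _ => ?_,
    fun k x _ y _ hx hy => ?_⟩
  · simp only [ContinuousMap.coe_mk]
    have := Finset.prod_univ_sum (fun i => Finset.univ) (fun i k => φ i k (x i))
    rw [Fintype.piFinset_univ] at this
    rw [← this]
    exact Finset.prod_eq_one fun i _ => h1 i _ trivial
  · choose S hSc hS0 using fun i => hS i (x i) trivial
    refine ⟨Fintype.piFinset S, ?_, fun k hk => ?_⟩
    · rw [Fintype.card_piFinset]
      exact (Finset.prod_le_prod' fun i _ => hSc i).trans (Nat.le_succ _)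
    · obtain ⟨i, hi⟩ : ∃ i, k i ∉ S i := by simpa [Fintype.mem_piFinset] using hk
      exact Finset.prod_eq_zero (Finset.mem_univ i) (hS0 i _ hi)
  · rw [dist_pi_lt_iff hδ]
    intro i
    exact hd i (k i) _ trivial _ trivial
      (fun h => hx (Finset.prod_eq_zero (Finset.mem_univ i) h))
      (fun h => hy (Finset.prod_eq_zero (Finset.mem_univ i) h))

/-! ### General position by Hausdorff dimension -/

section GeneralPosition

variable {ι κ Y Z : Type*} [Fintype ι] [Fintype κ]
  [NormedAddCommGroup Y] [NormedSpace ℝ Y] [FiniteDimensional ℝ Y]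
  [NormedAddCommGroup Z] [NormedSpace ℝ Z] [FiniteDimensional ℝ Z]

/-- As the coefficient at `i₀` is 1, the equation can be solved for the vertex at `i₀`. Coincidences
thus lie in the image of a C¹ map whose domain has `Θ` in place of one copy of `Y`, which lowers the
dimension. -/
lemma dimH_coincidence_le {Θ : Type*} [NormedAddCommGroup Θ] [NormedSpace ℝ Θ]
    [FiniteDimensional ℝ Θ] (R : Z →L[ℝ] Y) {A : Θ → ι → ℝ} {B : Θ → κ → ℝ}
    (hA : ContDiff ℝ 1 A) (hB : ContDiff ℝ 1 B) (i₀ : ι) (hA₀ : ∀ θ, A θ i₀ = 1)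
    (hdim : Module.finrank ℝ Θ < Module.finrank ℝ Y) :
    dimH {P : (ι → Y) × (κ → Z) | ∃ θ, ∑ i, A θ i • P.1 i = R (∑ k, B θ k • P.2 k)} ≤
      ((Module.finrank ℝ ((ι → Y) × (κ → Z)) - 1 : ℕ) : ℝ≥0∞) := by
  classical
  have hA' : ∀ i, ContDiff ℝ 1 fun θ => A θ i := fun i => contDiff_pi.1 hA i
  have hB' : ∀ k, ContDiff ℝ 1 fun θ => B θ k := fun k => contDiff_pi.1 hB k
  let Ψ : Θ × ({i // i ≠ i₀} → Y) × (κ → Z) → (ι → Y) × (κ → Z) := fun q =>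
    (fun i => if h : i = i₀ then
      R (∑ k, B q.1 k • q.2.2 k) - ∑ i : {i // i ≠ i₀}, A q.1 i • q.2.1 i
      else q.2.1 ⟨i, h⟩, q.2.2)
  have hΨ : ContDiff ℝ 1 Ψ := by
    refine ContDiff.prodMk (contDiff_pi.2 fun i => ?_) (by fun_prop)
    by_cases h : i = i₀
    · simp only [h, dite_true]
      refine ContDiff.sub (R.contDiff.comp (ContDiff.sum fun k _ => ?_))
        (ContDiff.sum fun i _ => ?_)
      · exact ((hB' k).comp contDiff_fst).smul (by fun_prop)
      · exact ((hA' i).comp contDiff_fst).smul (by fun_prop)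
    · simp only [h, dite_false]
      fun_prop
  have hsub : {P : (ι → Y) × (κ → Z) | ∃ θ, ∑ i, A θ i • P.1 i = R (∑ k, B θ k • P.2 k)} ⊆
      Set.range Ψ := by
    rintro P ⟨θ, hθ⟩
    refine ⟨(θ, fun i => P.1 i, P.2), ?_⟩
    refine Prod.ext (funext fun i => ?_) rfl
    by_cases h : i = i₀
    · subst h
      simp only [Ψ, dite_true]
      rw [← hθ, Fintype.sum_eq_add_sum_subtype_ne _ i, hA₀, one_smul]
      simp
    · simp [Ψ, h]
  refine (dimH_mono hsub).trans (hΨ.dimH_range_le.trans ?_)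
  norm_cast
  have hc : Fintype.card {i // i ≠ i₀} + 1 = Fintype.card ι := by
    have := Fintype.card_pos_iff.2 ⟨i₀⟩
    simp [Fintype.card_subtype_compl]; omega
  simp only [Module.finrank_prod, Module.finrank_pi_fintype, Finset.sum_const, Finset.card_univ,
    smul_eq_mul]
  rw [← hc, add_mul]
  omega

lemma dense_of_dimH_compl_iUnion_le {E Q : Type*} [NormedAddCommGroup E] [NormedSpace ℝ E]
    [FiniteDimensional ℝ E] [Nontrivial E] [Countable Q] {G : Set E} (C : Q → Set E)
    (hC : ∀ q, dimH (C q) ≤ ((Module.finrank ℝ E - 1 : ℕ) : ℝ≥0∞)) (h : Gᶜ ⊆ ⋃ q, C q) :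
    Dense G := by
  rw [← compl_compl G]
  refine dense_compl_of_dimH_lt_finrank (lt_of_le_of_lt ((dimH_mono h).trans ?_)
    (?_ : ((Module.finrank ℝ E - 1 : ℕ) : ℝ≥0∞) < _))
  · rw [dimH_iUnion]
    exact iSup_le hC
  · have := Module.finrank_pos (R := ℝ) (M := E)
    exact_mod_cast (by omega : Module.finrank ℝ E - 1 < Module.finrank ℝ E)

/-- The vector supported on `S` with value `c` at `i₀` and values `θ` at the other points. -/
def supportedVector [DecidableEq ι] (S : Finset ι) (i₀ : ι) (c : ℝ) (θ : ↥(S.erase i₀) → ℝ)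
    (i : ι) : ℝ :=
  if i = i₀ then c else if h : i ∈ S.erase i₀ then θ ⟨i, h⟩ else 0

lemma contDiff_supportedVector [DecidableEq ι] {Θ : Type*} [NormedAddCommGroup Θ]
    [NormedSpace ℝ Θ] (S : Finset ι) (i₀ : ι) {c : Θ → ℝ} {θ : Θ → ↥(S.erase i₀) → ℝ}
    (hc : ContDiff ℝ 1 c) (hθ : ContDiff ℝ 1 θ) :
    ContDiff ℝ 1 fun x => supportedVector S i₀ (c x) (θ x) := by
  refine contDiff_pi.2 fun i => ?_
  unfold supportedVector
  split_ifs
  · exact hc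
  · exact contDiff_pi.1 hθ _
  · exact contDiff_const

omit [Fintype ι] in
lemma supportedVector_eq [DecidableEq ι] {S : Finset ι} {s : ι → ℝ} (hs : ∀ i ∉ S, s i = 0)
    (i₀ : ι) {c : ℝ} (hc : s i₀ = c) : supportedVector S i₀ c (fun i => s i) = s := by
  funext i
  unfold supportedVector
  split_ifs with h h'
  · rw [h, hc]
  · rfl
  · rw [hs i fun hi => h' (Finset.mem_erase.2 ⟨h, hi⟩)]

lemma sum_eq_add_sum_erase [DecidableEq ι] {S : Finset ι} {s : ι → ℝ} (hs : ∀ i ∉ S, s i = 0)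
    {i₀ : ι} (hi₀ : i₀ ∈ S) : ∑ i, s i = s i₀ + ∑ i : ↥(S.erase i₀), s i := by
  rw [Finset.sum_coe_sort (S.erase i₀), Finset.add_sum_erase S s hi₀]
  exact (Finset.sum_subset (Finset.subset_univ S) fun i _ hi => hs i hi).symm

lemma exists_mem_ne_zero {S : Finset ι} {s : ι → ℝ} (hs : ∀ i ∉ S, s i = 0)
    (h1 : ∑ i, s i = 1) : ∃ i ∈ S, s i ≠ 0 := by
  by_contra! h
  rw [Finset.sum_eq_zero fun i _ => (Classical.em (i ∈ S)).elim (h i) (hs i)] at h1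
  exact zero_ne_one h1

/-- Dividing by some `s i₀ ≠ 0` makes the coefficient at `i₀` equal to 1. At most `n + m` parameters
remain, because the coefficient at `k₀` is forced by the equality of the two sums. -/
lemma dense_pairs_in_general_position (R : Z →L[ℝ] Y) {n m : ℕ}
    (hnm : n + m < Module.finrank ℝ Y) :
    Dense {P : (ι → Y) × (κ → Z) | ∀ (s : ι → ℝ) (t : κ → ℝ),
      (∃ S : Finset ι, S.card ≤ n + 1 ∧ ∀ i ∉ S, s i = 0) →
      (∃ S : Finset κ, S.card ≤ m + 1 ∧ ∀ k ∉ S, t k = 0) →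
      ∑ i, s i = 1 → ∑ k, t k = 1 → ∑ i, s i • P.1 i ≠ R (∑ k, t k • P.2 k)} := by
  classical
  have : Nontrivial Y := Module.nontrivial_of_finrank_pos (R := ℝ) (by omega)
  cases isEmpty_or_nonempty ι with
  | inl h =>
    convert dense_univ
    refine Set.eq_univ_of_forall fun P s t _ _ h1 => ?_
    simp at h1
  | inr h =>
  let C : Finset ι × Finset κ × ι × κ → Set ((ι → Y) × (κ → Z)) := fun q =>
    {P | q.1.card ≤ n + 1 ∧ q.2.1.card ≤ m + 1 ∧ q.2.2.1 ∈ q.1 ∧ q.2.2.2 ∈ q.2.1 ∧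
      ∃ θ : (↥(q.1.erase q.2.2.1) → ℝ) × (↥(q.2.1.erase q.2.2.2) → ℝ),
        ∑ i, supportedVector q.1 q.2.2.1 1 θ.1 i • P.1 i =
        R (∑ k, supportedVector q.2.1 q.2.2.2 (1 + ∑ i, θ.1 i - ∑ k, θ.2 k) θ.2 k • P.2 k)}
  refine dense_of_dimH_compl_iUnion_le C ?_ ?_
  · rintro ⟨S, T, i₀, k₀⟩
    by_cases hq : S.card ≤ n + 1 ∧ T.card ≤ m + 1 ∧ i₀ ∈ S ∧ k₀ ∈ T
    · obtain ⟨hS, hT, hi, hk⟩ := hq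
      refine (dimH_mono ?_).trans (dimH_coincidence_le R
        (A := fun θ : (↥(S.erase i₀) → ℝ) × (↥(T.erase k₀) → ℝ) => supportedVector S i₀ 1 θ.1)
        (B := fun θ => supportedVector T k₀ (1 + ∑ i, θ.1 i - ∑ k, θ.2 k) θ.2)
        (contDiff_supportedVector _ _ (by fun_prop) (by fun_prop))
        (contDiff_supportedVector _ _ (by fun_prop) (by fun_prop)) i₀
        (fun θ => by simp [supportedVector]) ?_)
      · exact fun P hP => hP.2.2.2.2
      · simp only [Module.finrank_prod, Module.finrank_fintype_fun_eq_card, Fintype.card_coe,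
          Finset.card_erase_of_mem hi, Finset.card_erase_of_mem hk]
        omega
    · have : C (S, T, i₀, k₀) = ∅ := Set.eq_empty_of_forall_notMem fun P hP =>
        hq ⟨hP.1, hP.2.1, hP.2.2.1, hP.2.2.2.1⟩
      rw [this, dimH_empty]
      exact zero_le
  · intro P hP
    simp only [Set.mem_compl_iff, Set.mem_ofPred_eq, not_forall, not_not] at hP
    obtain ⟨s, t, ⟨S, hS, hS0⟩, ⟨T, hT, hT0⟩, hs1, ht1, heq⟩ := hP
    obtain ⟨i₀, hi, hi0⟩ := exists_mem_ne_zero hS0 hs1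
    obtain ⟨k₀, hk, -⟩ := exists_mem_ne_zero hT0 ht1
    refine Set.mem_iUnion.2 ⟨(S, T, i₀, k₀), hS, hT, hi, hk,
      (fun i => (s i₀)⁻¹ * s i, fun k => (s i₀)⁻¹ * t k), ?_⟩
    have e1 := sum_eq_add_sum_erase hS0 hi
    have e2 := sum_eq_add_sum_erase hT0 hk
    rw [supportedVector_eq (s := fun i => (s i₀)⁻¹ * s i) (fun i hi => by simp [hS0 i hi]) i₀
      (inv_mul_cancel₀ hi0), supportedVector_eq (s := fun k => (s i₀)⁻¹ * t k)
      (fun i hi => by simp [hT0 i hi]) k₀]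
    · simp only [mul_smul, ← Finset.smul_sum, heq, map_smul]
    · rw [← Finset.mul_sum, ← Finset.mul_sum]
      have e3 : ∑ i : ↥(S.erase i₀), s i = 1 - s i₀ := by linarith
      have e4 : ∑ k : ↥(T.erase k₀), t k = 1 - t k₀ := by linarith
      rw [e3, e4]
      field_simp
      ring

/-- With the same weights on both sides there are only `n` parameters, which is what pairs on one
orbit require. -/
lemma dense_single_in_general_position (R : Z →L[ℝ] Y) {n : ℕ}
    (hn : n < Module.finrank ℝ Y) :
    Dense {P : (ι → Y) × (ι → Z) | ∀ s : ι → ℝ,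
      (∃ S : Finset ι, S.card ≤ n + 1 ∧ ∀ i ∉ S, s i = 0) →
      ∑ i, s i = 1 → ∑ i, s i • P.1 i ≠ R (∑ i, s i • P.2 i)} := by
  classical
  have : Nontrivial Y := Module.nontrivial_of_finrank_pos (R := ℝ) (by omega)
  cases isEmpty_or_nonempty ι with
  | inl h =>
    convert dense_univ
    refine Set.eq_univ_of_forall fun P s _ h1 => ?_
    simp at h1
  | inr h =>
  let C : Finset ι × ι → Set ((ι → Y) × (ι → Z)) := fun q =>
    {P | q.1.card ≤ n + 1 ∧ q.2 ∈ q.1 ∧ ∃ θ : ↥(q.1.erase q.2) → ℝ,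
        ∑ i, supportedVector q.1 q.2 1 θ i • P.1 i =
        R (∑ i, supportedVector q.1 q.2 1 θ i • P.2 i)}
  refine dense_of_dimH_compl_iUnion_le C ?_ ?_
  · rintro ⟨S, i₀⟩
    by_cases hq : S.card ≤ n + 1 ∧ i₀ ∈ S
    · obtain ⟨hS, hi⟩ := hq
      have hA := contDiff_supportedVector (Θ := ↥(S.erase i₀) → ℝ) S i₀
        (c := fun _ => 1) (θ := fun θ => θ) (by fun_prop) (by fun_prop)
      refine (dimH_mono ?_).trans (dimH_coincidence_le R hA hA i₀
        (fun θ => by simp [supportedVector]) ?_)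
      · exact fun P hP => hP.2.2
      · simp only [Module.finrank_fintype_fun_eq_card, Fintype.card_coe,
          Finset.card_erase_of_mem hi]
        omega
    · have : C (S, i₀) = ∅ := Set.eq_empty_of_forall_notMem fun P hP => hq ⟨hP.1, hP.2.1⟩
      rw [this, dimH_empty]
      exact zero_le
  · intro P hP
    simp only [Set.mem_compl_iff, Set.mem_ofPred_eq, not_forall, not_not] at hP
    obtain ⟨s, ⟨S, hS, hS0⟩, hs1, heq⟩ := hP
    obtain ⟨i₀, hi, hi0⟩ := exists_mem_ne_zero hS0 hs1
    refine Set.mem_iUnion.2 ⟨(S, i₀), hS, hi, fun i => (s i₀)⁻¹ * s i, ?_⟩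
    rw [supportedVector_eq (s := fun i => (s i₀)⁻¹ * s i) (fun i hi => by simp [hS0 i hi]) i₀
      (inv_mul_cancel₀ hi0)]
    simp only [mul_smul, ← Finset.smul_sum, heq, map_smul]

end GeneralPosition

/-! ### Perturbing a function along disjoint translates -/

section Perturbation

variable {X : Type u} [MetricSpace X] [CompactSpace X]
  {W : Type*} [NormedAddCommGroup W] [NormedSpace ℝ W]

/-- A convex selection: `h i` near `C i` and `f` away from all these sets are local solutions, glued
by a partition of unity. -/
lemma exists_continuous_eq_on_disjoint {I : Type*} [Finite I] {C : I → Set X}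
    (hC : ∀ i, IsClosed (C i)) (hd : Pairwise fun i j => Disjoint (C i) (C j))
    (h : I → C(X, W)) (f : C(X, W)) {ε : ℝ} (hε : 0 < ε)
    (hf : ∀ i, ∀ x ∈ C i, dist (h i x) (f x) < ε) :
    ∃ g : C(X, W), dist g f < ε ∧ ∀ i, ∀ x ∈ C i, g x = h i x := by
  let t : X → Set W := fun x => Metric.ball (f x) ε ∩ ⋂ i, ⋂ (_ : x ∈ C i), {h i x}
  obtain ⟨g, hg⟩ := exists_continuous_forall_mem_convex_of_local (t := t)
    (fun x => (convex_ball _ _).inter (convex_iInter fun i => convex_iInter fun _ =>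
      convex_singleton _)) (by
    intro x
    by_cases hx : ∃ i, x ∈ C i
    · obtain ⟨i, hi⟩ := hx
      have hclosed : IsClosed (⋃ j ∈ {j | j ≠ i}, C j) :=
        (Set.toFinite _).isClosed_biUnion fun j _ => hC j
      refine ⟨{y | dist (h i y) (f y) < ε} ∩ (⋃ j ∈ {j | j ≠ i}, C j)ᶜ,
        (((isOpen_lt (by fun_prop) continuous_const).inter hclosed.isOpen_compl).mem_nhds
          ⟨hf i x hi, ?_⟩), h i, (h i).continuous.continuousOn, fun y hy => ⟨hy.1, ?_⟩⟩
      · simp only [Set.mem_compl_iff, Set.mem_iUnion, not_exists]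
        exact fun j hj hxj => (hd hj).le_bot ⟨hxj, hi⟩
      · simp only [Set.mem_iInter]
        intro j hj
        by_cases hji : j = i
        · rw [hji]; rfl
        · exact absurd (Set.mem_biUnion hji hj) hy.2
    · have hclosed : IsClosed (⋃ j, C j) := isClosed_iUnion_of_finite hC
      refine ⟨(⋃ j, C j)ᶜ, hclosed.isOpen_compl.mem_nhds (by simpa using hx), f,
        f.continuous.continuousOn, fun y hy => ⟨Metric.mem_ball_self hε, ?_⟩⟩
      simp only [Set.mem_iInter]
      exact fun j hj => absurd (Set.mem_iUnion.2 ⟨j, hj⟩) hy)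
  refine ⟨g, (ContinuousMap.dist_lt_iff hε).2 fun x => (hg x).1, fun i x hx => ?_⟩
  exact Set.mem_iInter₂.1 (hg x).2 i hx

lemma dist_sum_smul_lt {ι : Type*} [Fintype ι] {s : ι → ℝ} (h0 : ∀ i, 0 ≤ s i)
    (h1 : ∑ i, s i = 1) {w : ι → W} {c : W} {ε : ℝ} (h : ∀ i, s i ≠ 0 → dist (w i) c < ε) :
    dist (∑ i, s i • w i) c < ε := by
  have := (convex_ball c ε).finsum_mem h0 (by rwa [finsum_eq_sum_of_fintype]) h
  rwa [finsum_eq_sum_of_fintype] at this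

/-- Half of `ε` bounds the oscillation of `f` on the supports, the other half pays for moving the
vertices into `G`. Disjoint translates allow the values at different times to be prescribed
independently. -/
lemma exists_perturbation {E J ι κ : Type*} [Fintype E] [Fintype J] [Fintype ι] [Fintype κ]
    (a : E → X ≃ₜ X) (b : J → X ≃ₜ X) {U V : Set X} (hU : IsClosed U) (hV : IsClosed V)
    (haa : Pairwise fun e e' => Disjoint (a e '' U) (a e' '' U))
    (hbb : Pairwise fun j j' => Disjoint (b j '' V) (b j' '' V))
    (hab : ∀ e j, Disjoint (a e '' U) (b j '' V))
    (φ : ι → C(X, ℝ)) (ψ : κ → C(X, ℝ)) (hφ0 : ∀ i x, 0 ≤ φ i x) (hψ0 : ∀ k x, 0 ≤ ψ k x)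
    (hφ1 : ∀ x ∈ U, ∑ i, φ i x = 1) (hψ1 : ∀ x ∈ V, ∑ k, ψ k x = 1)
    (f : C(X, W)) {ε : ℝ} (hε : 0 < ε)
    (hφ : ∀ i, ∀ x ∈ U, ∀ y ∈ U, φ i x ≠ 0 → φ i y ≠ 0 →
      ∀ e, dist (f (a e x)) (f (a e y)) < ε / 2)
    (hψ : ∀ k, ∀ x ∈ V, ∀ y ∈ V, ψ k x ≠ 0 → ψ k y ≠ 0 →
      ∀ j, dist (f (b j x)) (f (b j y)) < ε / 2)
    {G : Set ((ι → E → W) × (κ → J → W))} (hG : Dense G) :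
    ∃ P ∈ G, ∃ g : C(X, W), dist g f < ε ∧
      (∀ e, ∀ x ∈ U, g (a e x) = ∑ i, φ i x • P.1 i e) ∧
      ∀ j, ∀ x ∈ V, g (b j x) = ∑ k, ψ k x • P.2 k j := by
  have hp : ∀ i, ∃ p : E → W, ∀ x ∈ U, φ i x ≠ 0 → ∀ e, dist (p e) (f (a e x)) < ε / 2 := by
    intro i
    by_cases h : ∃ y ∈ U, φ i y ≠ 0
    · obtain ⟨y, hy, hy0⟩ := h
      exact ⟨fun e => f (a e y), fun x hx hx0 e => hφ i y hy x hx hy0 hx0 e⟩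
    · exact ⟨0, fun x hx hx0 => absurd ⟨x, hx, hx0⟩ h⟩
  have hq : ∀ k, ∃ q : J → W, ∀ x ∈ V, ψ k x ≠ 0 → ∀ j, dist (q j) (f (b j x)) < ε / 2 := by
    intro k
    by_cases h : ∃ y ∈ V, ψ k y ≠ 0
    · obtain ⟨y, hy, hy0⟩ := h
      exact ⟨fun j => f (b j y), fun x hx hx0 j => hψ k y hy x hx hy0 hx0 j⟩
    · exact ⟨0, fun x hx hx0 => absurd ⟨x, hx, hx0⟩ h⟩
  choose p hp using hp
  choose q hq using hq
  obtain ⟨P, hPG, hP⟩ := hG.exists_dist_lt (p, q) (half_pos hε)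
  have hP1 : ∀ i e, dist (P.1 i e) (p i e) < ε / 2 := fun i e => by
    rw [dist_comm]
    exact ((dist_le_pi_dist _ _ e).trans ((dist_le_pi_dist p P.1 i).trans
      (le_max_left _ _))).trans_lt hP
  have hP2 : ∀ k j, dist (P.2 k j) (q k j) < ε / 2 := fun k j => by
    rw [dist_comm]
    exact ((dist_le_pi_dist _ _ j).trans ((dist_le_pi_dist q P.2 k).trans
      (le_max_right _ _))).trans_lt hP
  let C : E ⊕ J → Set X := Sum.elim (fun e => a e '' U) (fun j => b j '' V)
  let h : E ⊕ J → C(X, W) := Sum.elim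
    (fun e => ⟨fun z => ∑ i, φ i ((a e).symm z) • P.1 i e, by fun_prop⟩)
    (fun j => ⟨fun z => ∑ k, ψ k ((b j).symm z) • P.2 k j, by fun_prop⟩)
  obtain ⟨g, hgf, hg⟩ := exists_continuous_eq_on_disjoint (C := C)
    (by
      rintro (e | j)
      · exact (a e).isClosedMap _ hU
      · exact (b j).isClosedMap _ hV)
    (by
      rintro (e | j) (e' | j') hne
      · exact haa fun h => hne (h ▸ rfl)
      · exact hab e j'
      · exact (hab e' j).symm
      · exact hbb fun h => hne (h ▸ rfl)) h f hε
    (by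
      rintro (e | j) _ ⟨x, hx, rfl⟩
      · simp only [h, Sum.elim_inl, ContinuousMap.coe_mk, Homeomorph.symm_apply_apply]
        refine dist_sum_smul_lt (fun i => hφ0 i x) (hφ1 x hx) fun i hi => ?_
        linarith [dist_triangle (P.1 i e) (p i e) (f (a e x)), hP1 i e, hp i x hx hi e]
      · simp only [h, Sum.elim_inr, ContinuousMap.coe_mk, Homeomorph.symm_apply_apply]
        refine dist_sum_smul_lt (fun i => hψ0 i x) (hψ1 x hx) fun k hk => ?_
        linarith [dist_triangle (P.2 k j) (q k j) (f (b j x)), hP2 k j, hq k x hx hk j])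
  refine ⟨P, hPG, g, hgf, fun e x hx => ?_, fun j x hx => ?_⟩
  · rw [hg (Sum.inl e) _ ⟨x, hx, rfl⟩]
    simp [h]
  · rw [hg (Sum.inr j) _ ⟨x, hx, rfl⟩]
    simp [h]

omit [NormedSpace ℝ W] in
lemma exists_delta_forall_dist_comp_lt {E : Type*} [Finite E] (a : E → X ≃ₜ X) (f : C(X, W))
    {ε : ℝ} (hε : 0 < ε) :
    ∃ δ > 0, ∀ x y, dist x y < δ → ∀ e, dist (f (a e x)) (f (a e y)) < ε := by
  cases nonempty_fintype E
  have huc : UniformContinuous fun x => fun e => f (a e x) :=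
    CompactSpace.uniformContinuous_of_continuous (by fun_prop)
  obtain ⟨δ, hδ, h⟩ := Metric.uniformContinuous_iff.1 huc ε hε
  exact ⟨δ, hδ, fun x y hxy e => (dist_le_pi_dist _ _ e).trans_lt (h hxy)⟩

variable [FiniteDimensional ℝ W]

/-- Precomposition with `ρ`. -/
def pullback (W : Type*) [NormedAddCommGroup W] [NormedSpace ℝ W] {E J : Type*} (ρ : E → J) :
    (J → W) →L[ℝ] (E → W) :=
  ContinuousLinearMap.pi fun e => ContinuousLinearMap.proj (ρ e)

/-- The map `ρ` matches a time for `x` with the time for `y` to compare it with. It is not injective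
when `y` has a short period and its orbit offers fewer points; this is why general position is
needed relative to a linear map. -/
lemma dense_separating_product {E J : Type*} [Fintype E] [Fintype J]
    (a : E → X ≃ₜ X) (b : J → X ≃ₜ X) (ρ : E → J) {U V : Set X} (hU : IsClosed U)
    (hV : IsClosed V) (haa : Pairwise fun e e' => Disjoint (a e '' U) (a e' '' U))
    (hbb : Pairwise fun j j' => Disjoint (b j '' V) (b j' '' V))
    (hab : ∀ e j, Disjoint (a e '' U) (b j '' V)) {n m : ℕ} (hn : HasFinePartitions U n)
    (hm : HasFinePartitions V m) (hnm : n + m < Fintype.card E * Module.finrank ℝ W) :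
    Dense {f : C(X, W) | ∀ x ∈ U, ∀ y ∈ V, ∃ e, f (a e x) ≠ f (b (ρ e) y)} := by
  refine Metric.dense_iff.2 fun f ε hε => ?_
  obtain ⟨δ₁, hδ₁, h₁⟩ := exists_delta_forall_dist_comp_lt a f (half_pos hε)
  obtain ⟨δ₂, hδ₂, h₂⟩ := exists_delta_forall_dist_comp_lt b f (half_pos hε)
  obtain ⟨ι, _, φ, hφ0, hφ1, hφS, hφd⟩ := hn δ₁ hδ₁
  obtain ⟨κ, _, ψ, hψ0, hψ1, hψS, hψd⟩ := hm δ₂ hδ₂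
  obtain ⟨P, hP, g, hgf, hga, hgb⟩ := exists_perturbation a b hU hV haa hbb hab φ ψ hφ0 hψ0 hφ1
    hψ1 f hε (fun i x hx y hy hx0 hy0 => h₁ x y (hφd i x hx y hy hx0 hy0))
    (fun i x hx y hy hx0 hy0 => h₂ x y (hψd i x hx y hy hx0 hy0))
    (dense_pairs_in_general_position (ι := ι) (κ := κ) (pullback W ρ) (n := n) (m := m)
      (by simpa [Module.finrank_pi_fintype] using hnm))
  refine ⟨g, hgf, fun x hx y hy => ?_⟩
  by_contra! hcon
  refine hP (fun i => φ i x) (fun k => ψ k y) (hφS x hx) (hψS y hy) (hφ1 x hx) (hψ1 y hy) ?_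
  funext e
  have := hcon e
  rw [hga e x hx, hgb (ρ e) y hy] at this
  simpa [pullback] using this

lemma dense_separating_diagonal {E J : Type*} [Fintype E] [Fintype J]
    (a : E → X ≃ₜ X) (b : J → X ≃ₜ X) (ρ : E → J) {U : Set X} (hU : IsClosed U)
    (haa : Pairwise fun e e' => Disjoint (a e '' U) (a e' '' U))
    (hbb : Pairwise fun j j' => Disjoint (b j '' U) (b j' '' U))
    (hab : ∀ e j, Disjoint (a e '' U) (b j '' U)) {n : ℕ} (hn : HasFinePartitions U n)
    (hnE : n < Fintype.card E * Module.finrank ℝ W) :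
    Dense {f : C(X, W) | ∀ x ∈ U, ∃ e, f (a e x) ≠ f (b (ρ e) x)} := by
  refine Metric.dense_iff.2 fun f ε hε => ?_
  obtain ⟨δ₁, hδ₁, h₁⟩ := exists_delta_forall_dist_comp_lt a f (half_pos hε)
  obtain ⟨δ₂, hδ₂, h₂⟩ := exists_delta_forall_dist_comp_lt b f (half_pos hε)
  obtain ⟨ι, _, φ, hφ0, hφ1, hφS, hφd⟩ := hn (min δ₁ δ₂) (lt_min hδ₁ hδ₂)
  obtain ⟨P, hP, g, hgf, hga, hgb⟩ := exists_perturbation a b hU hU haa hbb hab φ φ hφ0 hφ0 hφ1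
    hφ1 f hε
    (fun i x hx y hy hx0 hy0 => h₁ x y ((hφd i x hx y hy hx0 hy0).trans_le (min_le_left _ _)))
    (fun i x hx y hy hx0 hy0 => h₂ x y ((hφd i x hx y hy hx0 hy0).trans_le (min_le_right _ _)))
    (dense_single_in_general_position (ι := ι) (pullback W ρ) (n := n)
      (by simpa [Module.finrank_pi_fintype] using hnE))
  refine ⟨g, hgf, fun x hx => ?_⟩
  by_contra! hcon
  refine hP (fun i => φ i x) (hφS x hx) (hφ1 x hx) ?_
  funext e
  have := hcon e
  rw [hga e x hx, hgb (ρ e) x hx] at this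
  simpa [pullback] using this

end Perturbation

/-! ### Openness, and passage from local to global by Baire category -/

lemma isOpen_setOf_separating {X Z W E : Type*} [TopologicalSpace X] [CompactSpace X] [T2Space X]
    [TopologicalSpace Z] [TopologicalSpace W] [T2Space W] {A B : E → Z → X}
    (hA : ∀ e, Continuous (A e)) (hB : ∀ e, Continuous (B e)) {L : Set Z} (hL : IsCompact L) :
    IsOpen {f : C(X, W) | ∀ z ∈ L, ∃ e, f (A e z) ≠ f (B e z)} := by
  refine isOpen_iff_mem_nhds.2 fun f hf => ?_
  refine hL.eventually_forall_of_forall_eventually fun z hz => ?_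
  obtain ⟨e, he⟩ := hf z hz
  have : IsOpen {p : C(X, W) × Z | p.1 (A e p.2) ≠ p.1 (B e p.2)} := by
    have hA := hA e
    have hB := hB e
    exact isOpen_ne_fun (by fun_prop) (by fun_prop)
  filter_upwards [this.mem_nhds he] with p hp
  exact ⟨e, hp⟩

lemma homeomorph_pow_apply {X : Type*} [TopologicalSpace X] (T : X ≃ₜ X) (k : ℕ) (x : X) :
    (T ^ k) x = T^[k] x := by
  induction k generalizing x with
  | zero => rfl
  | succ k ih => rw [pow_succ, Function.iterate_succ_apply, ← ih]; rfl

/-- Second countability reduces a possibly non-compact stratum to countably many relative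
neighbourhoods. -/
lemma eventually_residual_of_local {Z F : Type*} [TopologicalSpace Z] [SecondCountableTopology Z]
    [TopologicalSpace F] {S : Set Z} {R : F → Z → Prop}
    (h : ∀ z ∈ S, ∃ N ∈ 𝓝[S] z, ∀ᶠ f in residual F, ∀ z ∈ N, R f z) :
    ∀ᶠ f in residual F, ∀ z ∈ S, R f z := by
  choose! N hN hR using h
  obtain ⟨t, htS, htc, hcov⟩ := TopologicalSpace.countable_cover_nhdsWithin hN
  filter_upwards [(eventually_countable_ball htc).2 fun z hz => hR z (htS hz)] with f hf z hz
  obtain ⟨y, hy, hzy⟩ := Set.mem_iUnion₂.1 (hcov hz)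
  exact hf y hy z hzy

lemma exists_radius_disjoint_images {X E J : Type*} [MetricSpace X] [Finite E] [Finite J]
    (a : E → X ≃ₜ X) (b : J → X ≃ₜ X) {x y : X} (ha : Function.Injective fun e => a e x)
    (hb : Function.Injective fun j => b j y) (hab : ∀ e j, a e x ≠ b j y) :
    ∃ r > 0,
      (Pairwise fun e e' => Disjoint (a e '' Metric.closedBall x r) (a e' '' Metric.closedBall x r)) ∧
      (Pairwise fun j j' => Disjoint (b j '' Metric.closedBall y r) (b j' '' Metric.closedBall y r)) ∧
      ∀ e j, Disjoint (a e '' Metric.closedBall x r) (b j '' Metric.closedBall y r) := by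
  obtain ⟨O, hO, hd⟩ := Set.Finite.t2_separation
    ((Set.finite_range fun e => a e x).union (Set.finite_range fun j => b j y))
  have hx : (⋂ e, a e ⁻¹' O (a e x)) ∈ 𝓝 x := Filter.iInter_mem.2 fun e =>
    (a e).continuous.continuousAt ((hO _).2.mem_nhds (hO _).1)
  have hy : (⋂ j, b j ⁻¹' O (b j y)) ∈ 𝓝 y := Filter.iInter_mem.2 fun j =>
    (b j).continuous.continuousAt ((hO _).2.mem_nhds (hO _).1)
  obtain ⟨r₁, hr₁, h₁⟩ := Metric.nhds_basis_closedBall.mem_iff.1 hx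
  obtain ⟨r₂, hr₂, h₂⟩ := Metric.nhds_basis_closedBall.mem_iff.1 hy
  have hA : ∀ e, a e '' Metric.closedBall x (min r₁ r₂) ⊆ O (a e x) := fun e =>
    Set.image_subset_iff.2 fun z hz =>
      Set.mem_iInter.1 (h₁ (Metric.closedBall_subset_closedBall (min_le_left _ _) hz)) e
  have hB : ∀ j, b j '' Metric.closedBall y (min r₁ r₂) ⊆ O (b j y) := fun j =>
    Set.image_subset_iff.2 fun z hz =>
      Set.mem_iInter.1 (h₂ (Metric.closedBall_subset_closedBall (min_le_right _ _) hz)) j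
  refine ⟨min r₁ r₂, lt_min hr₁ hr₂, fun e e' hne => ?_, fun j j' hne => ?_, fun e j => ?_⟩
  · exact (hd (Or.inl ⟨e, rfl⟩) (Or.inl ⟨e', rfl⟩) (ha.ne hne)).mono (hA e) (hA e')
  · exact (hd (Or.inr ⟨j, rfl⟩) (Or.inr ⟨j', rfl⟩) (hb.ne hne)).mono (hB j) (hB j')
  · exact (hd (Or.inl ⟨e, rfl⟩) (Or.inr ⟨j, rfl⟩) (hab e j)).mono (hA e) (hB j)

/-! ### Generic separation on a stratum of pairs -/

section Strata

variable {X : Type u} [MetricSpace X] [CompactSpace X]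
  {W : Type*} [NormedAddCommGroup W] [NormedSpace ℝ W] [FiniteDimensional ℝ W]

/-- The closed sets `S₁`, `S₂` carry the dimension bounds for the stratum `Q`; the times `I`, `J`
may vary with the pair. -/
lemma eventually_residual_separates_pairs (T : X ≃ₜ X) {S₁ S₂ : Set X} (hS₁ : IsClosed S₁)
    (hS₂ : IsClosed S₂) {n m : ℕ} (hn : HasFinePartitions S₁ n) (hm : HasFinePartitions S₂ m)
    (Q : X → X → Prop)
    (hQ : ∀ x y, Q x y → x ∈ S₁ ∧ y ∈ S₂ ∧ ∃ (I J : Finset ℕ) (ρ : ℕ → ℕ), (∀ i ∈ I, ρ i ∈ J) ∧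
      Set.InjOn (fun i => T^[i] x) I ∧ Set.InjOn (fun i => T^[i] y) J ∧
      (∀ i ∈ I, ∀ j ∈ J, T^[i] x ≠ T^[j] y) ∧
      (∀ z ∈ S₂, ∀ i ∈ I, T^[ρ i] z = T^[i] z) ∧ n + m < I.card * Module.finrank ℝ W) :
    ∀ᶠ f : C(X, W) in residual _, ∀ x y, Q x y → ∃ k : ℕ, f (T^[k] x) ≠ f (T^[k] y) := by
  suffices h : ∀ᶠ f : C(X, W) in residual _, ∀ z ∈ {z : X × X | Q z.1 z.2},
      ∃ k : ℕ, f (T^[k] z.1) ≠ f (T^[k] z.2) by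
    filter_upwards [h] with f hf x y hxy
    exact hf (x, y) hxy
  refine eventually_residual_of_local ?_
  rintro ⟨x, y⟩ hxy
  obtain ⟨-, -, I, J, ρ, hρ, hI, hJ, hIJ, hmod, hdim⟩ := hQ x y hxy
  let a : I → X ≃ₜ X := fun i => T ^ (i : ℕ)
  let b : J → X ≃ₜ X := fun j => T ^ (j : ℕ)
  obtain ⟨r, hr, haa, hbb, hab⟩ := exists_radius_disjoint_images a b (x := x) (y := y)
    (fun i j hij => Subtype.ext (hI i.2 j.2 (by simpa [a, homeomorph_pow_apply] using hij)))
    (fun i j hij => Subtype.ext (hJ i.2 j.2 (by simpa [b, homeomorph_pow_apply] using hij)))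
    (fun i j => by simpa [a, b, homeomorph_pow_apply] using hIJ i i.2 j j.2)
  have hU : IsClosed (Metric.closedBall x r ∩ S₁) := Metric.isClosed_closedBall.inter hS₁
  have hV : IsClosed (Metric.closedBall y r ∩ S₂) := Metric.isClosed_closedBall.inter hS₂
  have hUs : ∀ i : I, a i '' (Metric.closedBall x r ∩ S₁) ⊆ a i '' Metric.closedBall x r :=
    fun i => Set.image_mono Set.inter_subset_left
  have hVs : ∀ j : J, b j '' (Metric.closedBall y r ∩ S₂) ⊆ b j '' Metric.closedBall y r :=
    fun j => Set.image_mono Set.inter_subset_left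
  have hdense := dense_separating_product (W := W) a b (fun i => ⟨ρ i, hρ i i.2⟩) hU hV
    (fun e e' h => (haa h).mono (hUs e) (hUs e')) (fun e e' h => (hbb h).mono (hVs e) (hVs e'))
    (fun e j => (hab e j).mono (hUs e) (hVs j)) (hn.mono Set.inter_subset_right)
    (hm.mono Set.inter_subset_right) (by simpa using hdim)
  have hopen := isOpen_setOf_separating (W := W) (A := fun (i : I) (z : X × X) => a i z.1)
    (B := fun i z => b ⟨ρ i, hρ i i.2⟩ z.2) (fun i => by fun_prop) (fun i => by fun_prop)
    (hU.isCompact.prod hV.isCompact)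
  -- The times chosen for `(x, y)` serve this whole set. It is a neighbourhood only within the
  -- stratum, since `Q` forces membership in `S₁` and `S₂`.
  refine ⟨(Metric.closedBall x r ∩ S₁) ×ˢ (Metric.closedBall y r ∩ S₂), ?_, ?_⟩
  · refine mem_nhdsWithin.2 ⟨Metric.ball x r ×ˢ Metric.ball y r,
      Metric.isOpen_ball.prod Metric.isOpen_ball,
      ⟨Metric.mem_ball_self hr, Metric.mem_ball_self hr⟩, ?_⟩
    rintro ⟨x', y'⟩ ⟨⟨hx', hy'⟩, hq⟩
    exact ⟨⟨Metric.ball_subset_closedBall hx', (hQ _ _ hq).1⟩,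
      ⟨Metric.ball_subset_closedBall hy', (hQ _ _ hq).2.1⟩⟩
  · refine Filter.mem_of_superset (residual_of_dense_open hopen (hdense.mono ?_)) ?_
    · exact fun f hf z hz => hf z.1 hz.1 z.2 hz.2
    · intro f hf z hz
      obtain ⟨i, hi⟩ := hf z hz
      refine ⟨i, ?_⟩
      simpa [a, b, homeomorph_pow_apply, hmod z.2 hz.2.2 i i.2] using hi

lemma eventually_residual_separates_diagonal (T : X ≃ₜ X) {S : Set X} (hS : IsClosed S)
    {n : ℕ} (hn : HasFinePartitions S n) (Q : X → Prop) {I J : Finset ℕ} {ρ : ℕ → ℕ}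
    (hρ : ∀ i ∈ I, ρ i ∈ J) (hdim : n < I.card * Module.finrank ℝ W)
    (hQ : ∀ x, Q x → x ∈ S ∧
      Set.InjOn (fun i => T^[i] x) I ∧ Set.InjOn (fun i => T^[i] x) J ∧
      (∀ i ∈ I, ∀ j ∈ J, T^[i] x ≠ T^[j] x)) :
    ∀ᶠ f : C(X, W) in residual _, ∀ x, Q x → ∃ i ∈ I, f (T^[i] x) ≠ f (T^[ρ i] x) := by
  refine eventually_residual_of_local (S := {x | Q x}) ?_
  intro x hx
  obtain ⟨-, hI, hJ, hIJ⟩ := hQ x hx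
  let a : I → X ≃ₜ X := fun i => T ^ (i : ℕ)
  let b : J → X ≃ₜ X := fun j => T ^ (j : ℕ)
  obtain ⟨r, hr, haa, hbb, hab⟩ := exists_radius_disjoint_images a b (x := x) (y := x)
    (fun i j hij => Subtype.ext (hI i.2 j.2 (by simpa [a, homeomorph_pow_apply] using hij)))
    (fun i j hij => Subtype.ext (hJ i.2 j.2 (by simpa [b, homeomorph_pow_apply] using hij)))
    (fun i j => by simpa [a, b, homeomorph_pow_apply] using hIJ i i.2 j j.2)
  have hU : IsClosed (Metric.closedBall x r ∩ S) := Metric.isClosed_closedBall.inter hS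
  have hUs : ∀ c : X ≃ₜ X, c '' (Metric.closedBall x r ∩ S) ⊆ c '' Metric.closedBall x r :=
    fun c => Set.image_mono Set.inter_subset_left
  have hdense := dense_separating_diagonal (W := W) a b (fun i => ⟨ρ i, hρ i i.2⟩) hU
    (fun e e' h => (haa h).mono (hUs _) (hUs _)) (fun e e' h => (hbb h).mono (hUs _) (hUs _))
    (fun e j => (hab e j).mono (hUs _) (hUs _)) (hn.mono Set.inter_subset_right)
    (by simpa using hdim)
  have hopen := isOpen_setOf_separating (W := W) (A := fun (i : I) (z : X) => a i z)
    (B := fun i z => b ⟨ρ i, hρ i i.2⟩ z) (fun i => by fun_prop) (fun i => by fun_prop)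
    hU.isCompact
  refine ⟨Metric.closedBall x r ∩ S, ?_, ?_⟩
  · refine mem_nhdsWithin.2 ⟨Metric.ball x r, Metric.isOpen_ball, Metric.mem_ball_self hr, ?_⟩
    rintro x' ⟨hx', hq⟩
    exact ⟨Metric.ball_subset_closedBall hx', (hQ _ hq).1⟩
  · refine Filter.mem_of_superset (residual_of_dense_open hopen hdense) ?_
    intro f hf z hz
    obtain ⟨i, hi⟩ := hf z hz
    refine ⟨i, i.2, ?_⟩
    simpa [a, b, homeomorph_pow_apply] using hi

end Strata

/-! ### Choice of times and periods of sequences -/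

section Times

variable {X : Type*} {T : X → X}

lemma injOn_iterate_of_forall_ne (hT : Function.Injective T) {x : X} {M : ℕ}
    (hx : ∀ p, 1 ≤ p → p ≤ M → T^[p] x ≠ x) :
    Set.InjOn (fun i => T^[i] x) (Set.Iic M) := by
  suffices h : ∀ i j, i < j → j ≤ M → T^[i] x ≠ T^[j] x by
    intro i hi j hj hij
    rcases lt_trichotomy i j with h' | h' | h'
    · exact absurd hij (h i j h' hj)
    · exact h'
    · exact absurd hij.symm (h j i h' hi)
  intro i j hij hj h
  obtain ⟨k, rfl⟩ := Nat.exists_eq_add_of_lt hij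
  rw [add_assoc, Function.iterate_add_apply] at h
  exact hx (k + 1) (by omega) (by omega) (hT.iterate i h).symm

/-- Greedy choice: `r` chosen times exclude at most `3 * r` others, namely themselves, the times
when `x` meets the chosen points of `y`, and vice versa; `4 * m + 1` candidates suffice. -/
lemma exists_free_times (hT : Function.Injective T) {x y : X} (hxy : x ≠ y) {m : ℕ}
    (hx : ∀ p, 1 ≤ p → p ≤ 4 * m → T^[p] x ≠ x) (hy : ∀ p, 1 ≤ p → p ≤ 4 * m → T^[p] y ≠ y) :
    ∃ I : Finset ℕ, I.card = m ∧ Set.InjOn (fun i => T^[i] x) I ∧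
      Set.InjOn (fun i => T^[i] y) I ∧ ∀ i ∈ I, ∀ j ∈ I, T^[i] x ≠ T^[j] y := by
  classical
  have hxi := injOn_iterate_of_forall_ne hT hx
  have hyi := injOn_iterate_of_forall_ne hT hy
  suffices h : ∀ r ≤ m, ∃ I : Finset ℕ, I.card = r ∧ (∀ i ∈ I, i ≤ 4 * m) ∧
      ∀ i ∈ I, ∀ j ∈ I, T^[i] x ≠ T^[j] y by
    obtain ⟨I, hI, hIm, hd⟩ := h m le_rfl
    exact ⟨I, hI, hxi.mono hIm, hyi.mono hIm, hd⟩
  intro r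
  induction r with
  | zero => exact fun _ => ⟨∅, by simp⟩
  | succ r ih =>
    intro hr
    obtain ⟨I, hI, hIm, hd⟩ := ih (by omega)
    let A := I.image fun i => T^[i] x
    let B := I.image fun i => T^[i] y
    let C := (Finset.range (4 * m + 1)).filter fun i => T^[i] x ∈ B
    let D := (Finset.range (4 * m + 1)).filter fun i => T^[i] y ∈ A
    have hC : C.card ≤ r := by
      refine (Finset.card_le_card_of_injOn (fun i => T^[i] x) (t := B) ?_ ?_).trans
        (Finset.card_image_le.trans hI.le)
      · exact fun i hi => (Finset.mem_filter.1 hi).2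
      · exact hxi.mono fun i hi => Nat.lt_succ_iff.1
          (Finset.mem_range.1 (Finset.mem_filter.1 hi).1)
    have hD : D.card ≤ r := by
      refine (Finset.card_le_card_of_injOn (fun i => T^[i] y) (t := A) ?_ ?_).trans
        (Finset.card_image_le.trans hI.le)
      · exact fun i hi => (Finset.mem_filter.1 hi).2
      · exact hyi.mono fun i hi => Nat.lt_succ_iff.1
          (Finset.mem_range.1 (Finset.mem_filter.1 hi).1)
    have hlt : (C ∪ D ∪ I).card < (Finset.range (4 * m + 1)).card := by
      have h1 := Finset.card_union_le (C ∪ D) I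
      have h2 := Finset.card_union_le C D
      rw [Finset.card_range]
      omega
    obtain ⟨i, hi, hin⟩ := Finset.exists_mem_notMem_of_card_lt_card hlt
    simp only [Finset.mem_union, not_or] at hin
    have hi' : i ≤ 4 * m := Nat.lt_succ_iff.1 (Finset.mem_range.1 hi)
    refine ⟨insert i I, by rw [Finset.card_insert_of_notMem hin.2, hI], ?_, ?_⟩
    · intro j hj
      rcases Finset.mem_insert.1 hj with rfl | hj
      · exact hi'
      · exact hIm j hj
    · intro j hj k hk
      rcases Finset.mem_insert.1 hj with hji | hjI <;>
        rcases Finset.mem_insert.1 hk with hki | hkI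
      · rw [hji, hki]
        exact (hT.iterate _).ne hxy
      · intro h
        exact hin.1.1 (Finset.mem_filter.2 ⟨hi, Finset.mem_image.2 ⟨k, hkI, hji ▸ h.symm⟩⟩)
      · intro h
        exact hin.1.2 (Finset.mem_filter.2 ⟨hi, Finset.mem_image.2 ⟨j, hjI, hki ▸ h⟩⟩)
      · exact hd j hjI k hkI

end Times

/-- Bézout: some multiple of `i` is congruent to the gcd modulo `p`. -/
lemma apply_add_gcd_of_periodic {β : Type*} {c : ℕ → β} {i p : ℕ} (hp : 0 < p) (hip : ¬ p ∣ i)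
    (hi : ∀ k, c (k + i) = c k) (hc : ∀ k, c (k + p) = c k) (k : ℕ) :
    c (k + Nat.gcd p i) = c k := by
  have hlt : Nat.gcd i p < p := by
    refine lt_of_le_of_ne (Nat.gcd_le_right _ hp) fun h => hip ?_
    rw [← h]
    exact Nat.gcd_dvd_left _ _
  obtain ⟨a, -, ha⟩ := Nat.exists_mul_mod_eq_gcd hlt
  have hpc : Function.Periodic c p := hc
  have hic : Function.Periodic c i := hi
  rw [Nat.gcd_comm, ← ha]
  have h1 : k + i * a = k + i * a % p + (i * a / p) * p := by
    have := Nat.mod_add_div (i * a) p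
    rw [mul_comm (i * a / p)]
    omega
  have h2 : c (k + i * a % p) = c (k + i * a) := by
    rw [h1]
    exact (hpc.nat_mul (i * a / p) _).symm
  rw [h2, mul_comm]
  exact hic.nat_mul a k

lemma isClosed_periodicLE {X : Type*} [TopologicalSpace X] [T2Space X] {T : X → X}
    (hT : Continuous T) (k : ℕ) : IsClosed (periodicLE T k) := by
  have : periodicLE T k = ⋃ p ∈ Set.Icc 1 k, {x | T^[p] x = x} := by
    ext x
    simp [periodicLE, Function.IsPeriodicPt, Function.IsFixedPt, and_assoc]
  rw [this]
  exact (Set.finite_Icc 1 k).isClosed_biUnion fun p _ => isClosed_eq (hT.iterate p) continuous_id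

/-! ### Finite-dimensional systems: generic injectivity of the orbit map -/

theorem eventually_residual_orbit_map_injective {X : Type u} [MetricSpace X] [CompactSpace X]
    {W : Type*} [NormedAddCommGroup W] [NormedSpace ℝ W] [FiniteDimensional ℝ W]
    (T : X ≃ₜ X) {N : ℕ} (hN : HasFinePartitions (Set.univ : Set X) N)
    (hP : ∀ k, 1 ≤ k → ∃ n, HasFinePartitions (periodicLE T k) n ∧
      2 * n < k * Module.finrank ℝ W) :
    ∀ᶠ f : C(X, W) in residual _, ∀ x y, x ≠ y → ∃ k : ℕ, f (T^[k] x) ≠ f (T^[k] y) := by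
  have hW : 1 ≤ Module.finrank ℝ W := by
    obtain ⟨n, -, hn⟩ := hP 1 le_rfl
    omega
  have hTi := T.injective
  let S : ℕ → Set X := fun p => {x | T^[p] x = x}
  have hS : ∀ p, IsClosed (S p) := fun p => isClosed_eq (T.continuous.iterate p) continuous_id
  have hSP : ∀ p, 1 ≤ p → S p ⊆ periodicLE T p := fun p hp x hx => ⟨p, hp, le_rfl, hx⟩
  -- Against `N + N` parameters, `2 * N + 1` times suffice because the target has dimension at least
  -- 1.
  let m := 2 * N + 1
  have hm : N + N < m * Module.finrank ℝ W := by
    have := Nat.mul_le_mul_left m hW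
    omega
  have hmemS : ∀ {p x}, Function.minimalPeriod T x = p → x ∈ S p := fun h =>
    h ▸ Function.isPeriodicPt_minimalPeriod T _
  have hinj : ∀ {p x}, Function.minimalPeriod T x = p →
      Set.InjOn (fun i => T^[i] x) (Set.Iio p) := fun h =>
    h ▸ Function.iterate_injOn_Iio_minimalPeriod
  have hmod : ∀ q, ∀ z ∈ S q, ∀ i, T^[i % q] z = T^[i] z := fun q z hz i =>
    Function.IsPeriodicPt.iterate_mod_apply hz i
  have free_free : ∀ᶠ f : C(X, W) in residual _, ∀ x y,
      (x ≠ y ∧ (∀ p, 1 ≤ p → p ≤ 4 * m → T^[p] x ≠ x) ∧ ∀ p, 1 ≤ p → p ≤ 4 * m → T^[p] y ≠ y) →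
      ∃ k : ℕ, f (T^[k] x) ≠ f (T^[k] y) := by
    refine eventually_residual_separates_pairs T isClosed_univ isClosed_univ hN hN _ ?_
    rintro x y ⟨hxy, hx, hy⟩
    obtain ⟨I, hIc, hIx, hIy, hI⟩ := exists_free_times hTi hxy hx hy
    exact ⟨trivial, trivial, I, I, id, fun i hi => hi, hIx, hIy, hI, fun _ _ _ _ => rfl,
      by rw [hIc]; exact hm⟩
  have free_periodic : ∀ q, ∀ᶠ f : C(X, W) in residual _, ∀ x y,
      (1 ≤ q ∧ q ≤ 4 * m ∧ (∀ p, 1 ≤ p → p ≤ 4 * m → T^[p] x ≠ x) ∧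
        Function.minimalPeriod T y = q) →
      ∃ k : ℕ, f (T^[k] x) ≠ f (T^[k] y) := by
    intro q
    refine eventually_residual_separates_pairs T isClosed_univ (hS q) hN
      (hN.mono (Set.subset_univ _)) _ ?_
    rintro x y ⟨hq, hqm, hx, hy⟩
    refine ⟨trivial, hmemS hy, Finset.range m, Finset.range q, (· % q),
      fun i _ => Finset.mem_range.2 (Nat.mod_lt _ hq), ?_, ?_, ?_, fun z hz i _ => hmod q z hz i,
      by rwa [Finset.card_range]⟩
    · refine (injOn_iterate_of_forall_ne hTi hx).mono fun i hi => ?_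
      have := Finset.mem_range.1 hi
      simp only [Set.mem_Iic]
      omega
    · simpa using hinj hy
    -- A common point of the two orbits would be fixed by `T^q`, giving `x` a period `q ≤ 4 * m`.
    · intro i _ j _ h
      refine hx q hq hqm (hTi.iterate i ?_)
      rw [← Function.iterate_add_apply, add_comm, Function.iterate_add_apply, h,
        ← Function.iterate_add_apply, add_comm, Function.iterate_add_apply]
      exact congrArg _ (hmemS hy)
  have periodic_periodic : ∀ p q, ∀ᶠ f : C(X, W) in residual _, ∀ x y,
      (1 ≤ q ∧ q ≤ p ∧ Function.minimalPeriod T x = p ∧ Function.minimalPeriod T y = q ∧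
        ∀ i, T^[i] x ≠ y) →
      ∃ k : ℕ, f (T^[k] x) ≠ f (T^[k] y) := by
    intro p q
    by_cases hpq : 1 ≤ q ∧ q ≤ p
    swap
    · exact Filter.Eventually.of_forall fun f x y h => absurd ⟨h.1, h.2.1⟩ hpq
    obtain ⟨hq, hqp⟩ := hpq
    obtain ⟨n₁, hn₁, hlt₁⟩ := hP p (hq.trans hqp)
    obtain ⟨n₂, hn₂, hlt₂⟩ := hP q hq
    refine eventually_residual_separates_pairs T (hS p) (hS q)
      (hn₁.mono (hSP p (hq.trans hqp))) (hn₂.mono (hSP q hq)) _ ?_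
    rintro x y ⟨-, -, hx, hy, hxy⟩
    refine ⟨hmemS hx, hmemS hy, Finset.range p, Finset.range q, (· % q),
      fun i _ => Finset.mem_range.2 (Nat.mod_lt _ hq), ?_, ?_, ?_, fun z hz i _ => hmod q z hz i,
      ?_⟩
    · simpa using hinj hx
    · simpa using hinj hy
    · intro i _ j hj h
      refine hxy (q - j + i) ?_
      rw [Function.iterate_add_apply, h, ← Function.iterate_add_apply,
        Nat.sub_add_cancel (Finset.mem_range.1 hj).le]
      exact hmemS hy
    · rw [Finset.card_range]
      have := Nat.mul_le_mul_right (Module.finrank ℝ W) hqp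
      omega
  have same_orbit : ∀ p g, ∀ᶠ f : C(X, W) in residual _, ∀ x,
      (1 ≤ g ∧ g < p ∧ g ∣ p ∧ Function.minimalPeriod T x = p) →
      ∃ i ∈ Finset.Ico g p, f (T^[i] x) ≠ f (T^[i % g] x) := by
    intro p g
    by_cases hpg : 1 ≤ g ∧ g < p ∧ g ∣ p
    swap
    · exact Filter.Eventually.of_forall fun f x h => absurd ⟨h.1, h.2.1, h.2.2.1⟩ hpg
    obtain ⟨hg, hgp, c, hc⟩ := hpg
    obtain ⟨n, hn, hlt⟩ := hP p (by omega)
    refine eventually_residual_separates_diagonal T (hS p) (hn.mono (hSP p (by omega))) _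
      (J := Finset.range g) (ρ := (· % g))
      (fun i _ => Finset.mem_range.2 (Nat.mod_lt _ hg)) ?_ ?_
    · rw [Nat.card_Ico]
      have hc2 : 2 ≤ c := by
        by_contra! h
        interval_cases c <;> omega
      -- A proper divisor is at most half of `p`, so there are at least `p/2` comparison times and
      -- `2 * n` below `p` times the dimension is enough.
      have h1 : p ≤ 2 * (p - g) := by
        have := Nat.mul_le_mul_left g hc2
        omega
      have := Nat.mul_le_mul_right (Module.finrank ℝ W) h1
      rw [mul_assoc] at this
      omega
    · rintro x ⟨-, -, -, hx⟩
      refine ⟨hmemS hx, (hinj hx).mono fun i hi => ?_, (hinj hx).mono fun i hi => ?_, ?_⟩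
      · exact (Finset.mem_Ico.1 hi).2
      · exact (Finset.mem_range.1 hi).trans hgp
      · intro i hi j hj h
        have h1 := Finset.mem_Ico.1 hi
        have h2 := Finset.mem_range.1 hj
        have := hinj hx (Set.mem_Iio.2 h1.2) (Set.mem_Iio.2 (h2.trans hgp)) h
        omega
  rw [← eventually_countable_forall] at free_periodic
  simp only [← eventually_countable_forall] at periodic_periodic same_orbit
  filter_upwards [free_free, free_periodic, periodic_periodic, same_orbit] with f h₁ h₂ h₃ h₄
  have periodic_case : ∀ x y p q, x ≠ y → 1 ≤ q → q ≤ p → Function.minimalPeriod T x = p →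
      Function.minimalPeriod T y = q → ∃ k : ℕ, f (T^[k] x) ≠ f (T^[k] y) := by
    intro x y p q hxy hq hqp hx hy
    by_cases horb : ∀ i, T^[i] x ≠ y
    · exact h₃ p q x y ⟨hq, hqp, hx, hy, horb⟩
    push Not at horb
    obtain ⟨i, rfl⟩ := horb
    -- Without separation the sequence `f (T^k x)` has periods `p` and `i`, hence also their gcd, a
    -- proper divisor of `p`; `same_orbit` forbids this.
    by_contra! hcon
    have hpi : ¬ p ∣ i := by
      rintro ⟨c, rfl⟩
      exact hxy (Function.IsPeriodicPt.mul_const (hmemS hx) c).symm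
    have hgp : Nat.gcd p i < p := by
      refine lt_of_le_of_ne (Nat.gcd_le_left _ (by omega)) fun h => hpi ?_
      rw [← h]
      exact Nat.gcd_dvd_right _ _
    have hper : Function.Periodic (fun k => f (T^[k] x)) (Nat.gcd p i) :=
      apply_add_gcd_of_periodic (c := fun k => f (T^[k] x)) (by omega) hpi
        (fun k => by simp only [Function.iterate_add_apply]; exact (hcon k).symm)
        (fun k => by simp only [Function.iterate_add_apply]; exact congrArg _ (congrArg _ (hmemS hx)))
    obtain ⟨j, -, hj⟩ := h₄ p (Nat.gcd p i) x
      ⟨Nat.gcd_pos_of_pos_left _ (by omega), hgp, Nat.gcd_dvd_left _ _, hx⟩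
    exact hj (hper.map_mod_nat j).symm
  intro x y hxy
  by_cases hx : ∀ p, 1 ≤ p → p ≤ 4 * m → T^[p] x ≠ x <;>
    by_cases hy : ∀ p, 1 ≤ p → p ≤ 4 * m → T^[p] y ≠ y
  · exact h₁ x y ⟨hxy, hx, hy⟩
  · push Not at hy
    obtain ⟨p, hp, hpm, hpy⟩ := hy
    have hpy' : Function.IsPeriodicPt T p y := hpy
    exact h₂ _ x y ⟨hpy'.minimalPeriod_pos hp, (hpy'.minimalPeriod_le hp).trans hpm, hx, rfl⟩
  · push Not at hx
    obtain ⟨p, hp, hpm, hpx⟩ := hx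
    have hpx' : Function.IsPeriodicPt T p x := hpx
    obtain ⟨k, hk⟩ := h₂ _ y x
      ⟨hpx'.minimalPeriod_pos hp, (hpx'.minimalPeriod_le hp).trans hpm, hy, rfl⟩
    exact ⟨k, hk.symm⟩
  · push Not at hx hy
    obtain ⟨p, hp, -, hpx⟩ := hx
    obtain ⟨q, hq, -, hqy⟩ := hy
    have hpx' : Function.IsPeriodicPt T p x := hpx
    have hqy' : Function.IsPeriodicPt T q y := hqy
    rcases le_total (Function.minimalPeriod T y) (Function.minimalPeriod T x) with h | h
    · exact periodic_case x y _ _ hxy (hqy'.minimalPeriod_pos hq) h rfl rfl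
    · obtain ⟨k, hk⟩ := periodic_case y x _ _ hxy.symm (hpx'.minimalPeriod_pos hp) h rfl rfl
      exact ⟨k, hk.symm⟩

/-! ### From finite products to the infinite product -/

lemma exists_topDim_periodicLE_le_of_perdim_lt {X : Type*} [TopologicalSpace X] {T : X ≃ₜ X}
    {d : ℕ} (h : perdim T < (d : ℝ≥0∞) / 2) {k : ℕ} (hk : 1 ≤ k) :
    ∃ n : ℕ, topDim (periodicLE T k) ≤ n ∧ 2 * n < k * d := by
  have h1 : ((topDim (periodicLE T k) : ℕ∞) : ℝ≥0∞) / (k : ℝ≥0∞) < (d : ℝ≥0∞) / 2 :=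
    lt_of_le_of_lt (le_iSup₂ (f := fun k (_ : 1 ≤ k) =>
      ((topDim (periodicLE T k) : ℕ∞) : ℝ≥0∞) / (k : ℝ≥0∞)) k hk) h
  generalize topDim (periodicLE T k) = t at h1
  induction t using ENat.recTopCoe with
  | top => simp [ENNReal.top_div] at h1
  | coe n =>
    refine ⟨n, le_rfl, ?_⟩
    have hk0 : (k : ℝ≥0∞) ≠ 0 := by exact_mod_cast (by omega : k ≠ 0)
    rw [ENNReal.div_lt_iff (Or.inl hk0) (Or.inl (ENNReal.natCast_ne_top k)),
      ← ENNReal.mul_div_right_comm,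
      ENNReal.lt_div_iff_mul_lt (Or.inl two_ne_zero) (Or.inl ENNReal.ofNat_ne_top)] at h1
    have h2 : n * 2 < d * k := by exact_mod_cast h1
    rw [mul_comm 2, mul_comm k]
    exact h2

lemma exists_index_ne_of_isCompact {X : ℕ → Type*} [∀ i, TopologicalSpace (X i)]
    [∀ i, T2Space (X i)] {L : Set ((∀ i, X i) × ∀ i, X i)} (hL : IsCompact L)
    (hne : ∀ z ∈ L, z.1 ≠ z.2) :
    ∃ N, ∀ n ≥ N, ∀ z ∈ L, ∃ i : Fin n, z.1 i ≠ z.2 i := by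
  obtain ⟨t, ht⟩ := hL.elim_finite_subcover
    (fun i : ℕ => {z : (∀ i, X i) × ∀ i, X i | z.1 i ≠ z.2 i})
    (fun i => isOpen_ne_fun (by fun_prop) (by fun_prop))
    (fun z hz => by
      obtain ⟨i, hi⟩ := Function.ne_iff.1 (hne z hz)
      exact Set.mem_iUnion.2 ⟨i, hi⟩)
  refine ⟨t.sup id + 1, fun n hn z hz => ?_⟩
  obtain ⟨i, hi, hzi⟩ := Set.mem_iUnion₂.1 (ht hz)
  have : i ≤ t.sup id := Finset.le_sup (f := id) hi
  exact ⟨⟨i, by omega⟩, hzi⟩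

lemma isClosed_ge_dist {X W : Type*} [TopologicalSpace X] [PseudoMetricSpace W] (f : C(X, W))
    (ε : ℝ) : IsClosed {z : X × X | ε ≤ dist (f z.1) (f z.2)} :=
  isClosed_le continuous_const (by fun_prop)

lemma dense_orbit_map_injective_finProd {X : ℕ → Type*} [∀ i, TopologicalSpace (X i)]
    [∀ i, CompactSpace (X i)] [∀ i, TopologicalSpace.MetrizableSpace (X i)]
    (hdim : ∀ i, topDim (X i) ≠ ⊤) (T : ∀ i, X i ≃ₜ X i) {d n : ℕ}
    (hper : perdim (finProdSystem T n) < (d : ℝ≥0∞) / 2) :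
    Dense {g : C(∀ i : Fin n, X i, Fin d → ℝ) | ∀ x y, x ≠ y →
      ∃ k : ℕ, g ((finProdSystem T n)^[k] x) ≠ g ((finProdSystem T n)^[k] y)} := by
  let _ : ∀ i, MetricSpace (X i) := fun i => TopologicalSpace.metrizableSpaceMetric (X i)
  choose N hN using fun i => ENat.ne_top_iff_exists.1 (hdim i)
  have hfine : ∀ i, HasFinePartitions (Set.univ : Set (X i)) (N i) := fun i =>
    hasFinePartitions_univ_of_topDim_le (hN i).ge
  refine dense_of_mem_residual (eventually_residual_orbit_map_injective (finProdSystem T n)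
    (HasFinePartitions.pi fun i : Fin n => hfine i) fun k hk => ?_)
  obtain ⟨m, hm, hlt⟩ := exists_topDim_periodicLE_le_of_perdim_lt hper hk
  exact ⟨m, hasFinePartitions_of_topDim_le
    (isClosed_periodicLE (finProdSystem T n).continuous k) hm, by simpa using hlt⟩

lemma finProdSystem_iterate_restrict {X : ℕ → Type*} [∀ i, TopologicalSpace (X i)]
    (T : ∀ i, X i ≃ₜ X i) (n k : ℕ) (x : ∀ i, X i) :
    (finProdSystem T n)^[k] (fun i : Fin n => x i) = fun i : Fin n => (prodSystem T)^[k] x i :=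
  (Function.Semiconj.iterate_right (f := fun (x : ∀ i, X i) (i : Fin n) => x i)
    (ga := prodSystem T) (gb := finProdSystem T n) (fun _ => rfl) k x).symm

lemma dense_separating_of_isCompact {X : ℕ → Type*} [∀ i, TopologicalSpace (X i)]
    [∀ i, CompactSpace (X i)] [∀ i, T2Space (X i)] (T : ∀ i, X i ≃ₜ X i)
    {W : Type*} [NormedAddCommGroup W]
    (h : ∃ᶠ n in atTop, Dense {g : C(∀ i : Fin n, X i, W) | ∀ x y, x ≠ y →
      ∃ k : ℕ, g ((finProdSystem T n)^[k] x) ≠ g ((finProdSystem T n)^[k] y)})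
    {L : Set ((∀ i, X i) × ∀ i, X i)} (hL : IsCompact L) (hne : ∀ z ∈ L, z.1 ≠ z.2) :
    Dense {f : C(∀ i, X i, W) | ∀ z ∈ L,
      ∃ k : ℕ, f ((prodSystem T)^[k] z.1) ≠ f ((prodSystem T)^[k] z.2)} := by
  cases isEmpty_or_nonempty (∀ i, X i) with
  | inl hX =>
    convert dense_univ
    exact Set.eq_univ_of_forall fun f z _ => isEmptyElim z.1
  | inr hX =>
  obtain ⟨p⟩ := hX
  refine Metric.dense_iff.2 fun f ε hε => ?_
  obtain ⟨N₁, hN₁⟩ := exists_index_ne_of_isCompact hL hne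
  -- Beyond `N₂`, points that agree in the first `n` coordinates have values of `f` within `ε / 2`.
  obtain ⟨N₂, hN₂⟩ := exists_index_ne_of_isCompact (isClosed_ge_dist f (ε / 2)).isCompact
    (fun z hz hzz => by
      have : ε / 2 ≤ dist (f z.1) (f z.2) := hz
      rw [hzz, dist_self] at this
      linarith)
  obtain ⟨n, hn, hdense⟩ := frequently_atTop.1 h (max N₁ N₂)
  -- A section of the projection, filling the missing coordinates from the base point `p`.
  let s : C(∀ i : Fin n, X i, ∀ i, X i) :=
    ⟨fun x i => if hi : i < n then x ⟨i, hi⟩ else p i, continuous_pi fun i => by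
      by_cases hi : i < n
      · simpa only [hi, dite_true] using continuous_apply _
      · simpa only [hi, dite_false] using continuous_const⟩
  let π : C(∀ i, X i, ∀ i : Fin n, X i) := ⟨fun x i => x i, by fun_prop⟩
  obtain ⟨g, hg, hfg⟩ := hdense.exists_dist_lt (f.comp s) (half_pos hε)
  refine ⟨g.comp π, ?_, fun z hz => ?_⟩
  · rw [Metric.mem_ball, ContinuousMap.dist_lt_iff hε]
    intro x
    have h1 : dist (f x) (f (s (π x))) < ε / 2 := by
      by_contra! hcon
      obtain ⟨i, hi⟩ := hN₂ n (le_of_max_le_right hn) (x, s (π x)) hcon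
      exact hi (by simp [s, π])
    have h2 : dist (f (s (π x))) (g (π x)) < ε / 2 :=
      (ContinuousMap.dist_apply_le_dist (f := f.comp s) (g := g) (π x)).trans_lt hfg
    have h3 := dist_triangle (f x) (f (s (π x))) (g (π x))
    rw [dist_comm]
    exact lt_of_le_of_lt h3 (by linarith)
  · obtain ⟨i, hi⟩ := hN₁ n (le_of_max_le_left hn) z hz
    obtain ⟨k, hk⟩ := hg (π z.1) (π z.2) fun h => hi (congrFun h i)
    refine ⟨k, ?_⟩
    simpa only [π, ContinuousMap.coe_mk, ContinuousMap.comp_apply, finProdSystem_iterate_restrict] using hk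

lemma exists_orbit_map_injective {X : ℕ → Type*} [∀ i, TopologicalSpace (X i)]
    [∀ i, CompactSpace (X i)] [∀ i, TopologicalSpace.MetrizableSpace (X i)]
    (T : ∀ i, X i ≃ₜ X i) {W : Type*} [NormedAddCommGroup W] [CompleteSpace W]
    (h : ∃ᶠ n in atTop, Dense {g : C(∀ i : Fin n, X i, W) | ∀ x y, x ≠ y →
      ∃ k : ℕ, g ((finProdSystem T n)^[k] x) ≠ g ((finProdSystem T n)^[k] y)}) :
    ∃ f : C(∀ i, X i, W), ∀ x y, x ≠ y →
      ∃ k : ℕ, f ((prodSystem T)^[k] x) ≠ f ((prodSystem T)^[k] y) := by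
  let _ : MetricSpace (∀ i, X i) := TopologicalSpace.metrizableSpaceMetric (∀ i, X i)
  -- These compact sets exhaust the complement of the diagonal.
  let L : ℕ → Set ((∀ i, X i) × ∀ i, X i) := fun m => {z | 1 / (m + 1 : ℝ) ≤ dist z.1 z.2}
  have hL : ∀ m, IsCompact (L m) := fun m =>
    (isClosed_le continuous_const (by fun_prop)).isCompact
  have hLne : ∀ m, ∀ z ∈ L m, z.1 ≠ z.2 := fun m z hz h => by
    have h1 : 1 / (m + 1 : ℝ) ≤ dist z.1 z.2 := hz
    rw [h, dist_self] at h1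
    exact absurd h1 (not_le.2 (by positivity))
  have hres : ∀ᶠ f : C(∀ i, X i, W) in residual _, ∀ m, ∀ z ∈ L m,
      ∃ k : ℕ, f ((prodSystem T)^[k] z.1) ≠ f ((prodSystem T)^[k] z.2) :=
    eventually_countable_forall.2 fun m => residual_of_dense_open
      (isOpen_setOf_separating
        (A := fun k (z : (∀ i, X i) × ∀ i, X i) => (prodSystem T)^[k] z.1)
        (B := fun k z => (prodSystem T)^[k] z.2)
        (fun k => ((prodSystem T).continuous.iterate k).comp continuous_fst)
        (fun k => ((prodSystem T).continuous.iterate k).comp continuous_snd) (hL m))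
      (dense_separating_of_isCompact T h (hL m) (hLne m))
  obtain ⟨f, hf⟩ := (dense_of_mem_residual hres).nonempty
  refine ⟨f, fun x y hxy => ?_⟩
  obtain ⟨m, hm⟩ := exists_nat_one_div_lt (dist_pos.2 hxy)
  exact hf m (x, y) hm.le

/-- The sigmoid is injective, so no separation is lost; nonnegative times already give injectivity,
and the negative ones serve equivariance into the bilateral shift. -/
lemma embedsIn_shift_of_orbit_map_injective {X : Type*} [TopologicalSpace X] [CompactSpace X]
    (T : X ≃ₜ X) {d : ℕ} (f : C(X, Fin d → ℝ))
    (hf : ∀ x y, x ≠ y → ∃ k : ℕ, f (T^[k] x) ≠ f (T^[k] y)) :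
    EmbedsIn T (shift (Fin d → unitInterval)) := by
  refine ⟨fun x n i => unitInterval.sigmoid (f ((T ^ n) x) i), ?_, ?_⟩
  · refine (Continuous.isClosedEmbedding ?_ ?_).isEmbedding
    · refine continuous_pi fun n => continuous_pi fun i => ?_
      have := (T ^ n).continuous
      have := unitInterval.continuous_sigmoid
      fun_prop
    · intro x y hxy
      by_contra hne
      obtain ⟨k, hk⟩ := hf x y hne
      refine hk (funext fun i => ?_)
      have := unitInterval.sigmoid_injective (congrFun (congrFun hxy (k : ℤ)) i)
      simpa only [zpow_natCast, homeomorph_pow_apply] using this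
  · funext x n i
    have : (T ^ (n + 1)) x = (T ^ n) (T x) := by rw [zpow_add_one]; rfl
    simp [shift, this]

end PeriodicDim

theorem proposition26 {X : ℕ → Type*} [∀ i, TopologicalSpace (X i)]
    [∀ i, CompactSpace (X i)] [∀ i, TopologicalSpace.MetrizableSpace (X i)]
    (hdim : ∀ i, PeriodicDim.topDim (X i) ≠ ⊤)
    (T : ∀ i, X i ≃ₜ X i) (d : ℕ)
    (hper : liminf (fun n : ℕ => PeriodicDim.perdim (PeriodicDim.finProdSystem T n)) atTop
      < (d : ℝ≥0∞) / 2) :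
    PeriodicDim.EmbedsIn (PeriodicDim.prodSystem T)
      (PeriodicDim.shift (Fin d → unitInterval)) := by
  obtain ⟨f, hf⟩ := PeriodicDim.exists_orbit_map_injective T
    ((frequently_lt_of_liminf_lt (h := hper)).mono fun n hn =>
      PeriodicDim.dense_orbit_map_injective_finProd hdim T hn)
  exact PeriodicDim.embedsIn_shift_of_orbit_map_injective _ f hf
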